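/- Let $P_0^*,P_1^*$ be mutually absolutely continuous probability measures on a measurable space $(\mathcal Y,\mathcal A)$, let $\epsilon_0,\epsilon_1\in[0,1)$, and for $i=0,1$ let $$\mathcal P_i=\{(1-\epsilon_i)P_i^*+\epsilon_i R : R \text{ a probability measure on } (\mathcal Y,\mathcal A)\},$$ where $\epsilon_0,\epsilon_1$ are such that $\mathcal P_0\cap\mathcal P_1=\emptyset$. Let $\pi_0,\pi_1\in(0,1)$ with $\pi_0+\pi_1=1$ be the prior probabilities of two hypotheses $H_0,H_1$. In a tandem of $N$ agents, put $U_0=0$ and let agent $k$ ($1\le k\le N$) decide $U_k=\phi_k(Y_k,U_{k-1})\in\{0,1\}$, where $\phi_k$ is measurable and $Y_k$ is its private observation; under $H_i$ the observations $Y_1,\dots,Y_N$ are independent and $Y_k$ has a distribution $P_{i,k}\in\mathcal P_i$ (not necessarily the same for all $k$). For $\phi^{(N)}=(\phi_1,\dots,\phi_N)$ let $$P_N^{\mathrm{DD}}(\phi^{(N)})=\sup\Big\{\pi_0\,\Big(\prod_{k=1}^N P_{0,k}\Big)(U_N=1)+\pi_1\,\Big(\prod_{k=1}^N P_{1,k}\Big)(U_N=0)\;:\;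 P_{0,k}\in\mathcal P_0,\ P_{1,k}\in\mathcal P_1 \ (1\le k\le N)\Big\}.$$ Then the minimax error $\inf_{\phi^{(N)}}P_N^{\mathrm{DD}}(\phi^{(N)})$ tends to $0$ as $N\to\infty$ if and only if at least one of the following holds: 1. $\epsilon_0=0$ and the log-likelihood ratio $\log\frac{dP_1^*}{dP_0^*}$ is (essentially) unbounded from above; 2. $\epsilon_1=0$ and the log-likelihood ratio $\log\frac{dP_1^*}{dP_0^*}$ is (essentially) unbounded from below. In particular, if for every $N$ the rules $\phi^{(N)}$ attain this infimum, then $P_N^{\mathrm{DD}}(\phi^{(N)})\to0$ if and only if at least one of 1 and 2 holds. -/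

import Mathlib

open MeasureTheory Filter Topology

noncomputable section

namespace Tandem

variable {Y : Type*} [MeasurableSpace Y]

/-- The uncertainty class `{(1 - ε) P + ε R | R a probability measure on Y}` around the nominal
distribution `P`, with contamination `ε`. -/
def contaminationClass (ε : ℝ) (P : ProbabilityMeasure Y) : Set (ProbabilityMeasure Y) :=
  {Q | ∃ R : ProbabilityMeasure Y,
    (Q : Measure Y) = ENNReal.ofReal (1 - ε) • (P : Measure Y) + ENNReal.ofReal ε • (R : Measure Y)}

/-- A decision rule of one agent: a measurable function of the agent's own observation and of the
decision received from its predecessor. `true` is a decision for `H₁`, `false` one for `H₀`. -/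
abbrev DecisionRule (Y : Type*) [MeasurableSpace Y] : Type _ :=
  {φ : Y × Bool → Bool // Measurable φ}

/-- The decision `U_N` of the last of `N` agents, where `U_0 = 0` and
`U_k = φ_k (Y_k, U_{k-1})`. The agents `1, …, N` are indexed by `Fin N`. -/
def lastDecision : (N : ℕ) → (Fin N → DecisionRule Y) → (Fin N → Y) → Bool
  | 0, _, _ => false
  | N + 1, φ, y =>
    (φ (Fin.last N)).1
      (y (Fin.last N), lastDecision N (fun k => φ k.castSucc) (fun k => y k.castSucc))

/-- False alarm probability of agent `N` when the observations are independent with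
distributions `P k`. -/
def falseAlarm {N : ℕ} (φ : Fin N → DecisionRule Y) (P : Fin N → ProbabilityMeasure Y) : ℝ :=
  (Measure.pi fun k => (P k : Measure Y)).real {y | lastDecision N φ y = true}

/-- Missed detection probability of agent `N` when the observations are independent with
distributions `P k`. -/
def missedDetection {N : ℕ} (φ : Fin N → DecisionRule Y) (P : Fin N → ProbabilityMeasure Y) : ℝ :=
  (Measure.pi fun k => (P k : Measure Y)).real {y | lastDecision N φ y = false}

/-- Error probability of agent `N` for the priors `π₀`, `π₁`. -/
def errorProb (π₀ π₁ : ℝ) {N : ℕ} (φ : Fin N → DecisionRule Y)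
    (P₀ P₁ : Fin N → ProbabilityMeasure Y) : ℝ :=
  π₀ * falseAlarm φ P₀ + π₁ * missedDetection φ P₁

/-- Maximum error probability of agent `N` over all choices, separately for each agent and each
hypothesis, of observation distributions in the classes `𝒫₀` (under `H₀`), `𝒫₁` (under `H₁`). -/
def maxError (π₀ π₁ : ℝ) (𝒫₀ 𝒫₁ : Set (ProbabilityMeasure Y)) {N : ℕ}
    (φ : Fin N → DecisionRule Y) : ℝ :=
  ⨆ P : (Fin N → 𝒫₀) × (Fin N → 𝒫₁),
    errorProb π₀ π₁ φ (fun k => (P.1 k : ProbabilityMeasure Y))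
      (fun k => (P.2 k : ProbabilityMeasure Y))

/-- The optimal (minimax) error of decentralized detection with `N` agents. -/
def minimaxError (π₀ π₁ : ℝ) (𝒫₀ 𝒫₁ : Set (ProbabilityMeasure Y)) (N : ℕ) : ℝ :=
  ⨅ φ : Fin N → DecisionRule Y, maxError π₀ π₁ 𝒫₀ 𝒫₁ φ

end Tandem

end

/-! The false alarm probability and its counterpart under the other hypothesis are the laws of a
two-state chain driven by independent observations (`falseAlarm_succ`).

If both conditions fail, mixing each nominal law with the other yields members `Q₀`, `Q₁` of the
classes with mutual likelihood ratio at most some `C` (`exists_dominated_pair`). Observations i.i.d.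
from these already defeat every tandem: the sum of the two error probabilities cannot decrease once
it is at most `1/C`, and from the middle range a single step loses at most a factor `C`. Hence the
sum never falls below `1/C²` (`inv_sq_le_step`).

If condition 1 holds, some set `A` has positive mass under `P₀` but far larger mass under `P₁`. Let
about `δ / P₀(A)` agents raise a permanent alarm on `A` and the others relay. False alarms have
probability at most `δ`; contaminating `P₁` shrinks the mass of `A` by at most the factor `1 - ε₁`,
so detection is still almost certain (`exists_rule_of_unbounded`). Condition 2 is the mirror image,
by negating the decisions (`exists_flip`). -/

namespace Tandem

/-! ### The two-state recursion for the decisions, and order bounds for the errors. -/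

section Recursion

variable {Y : Type*} [MeasurableSpace Y]

lemma measurable_lastDecision :
    ∀ (N : ℕ) (φ : Fin N → DecisionRule Y), Measurable (lastDecision N φ)
  | 0, _ => measurable_const
  | N + 1, φ => (φ (Fin.last N)).2.comp ((measurable_pi_apply _).prodMk
      ((measurable_lastDecision N fun k => φ k.castSucc).comp
        (measurable_pi_lambda _ fun _ => measurable_pi_apply _)))

lemma missedDetection_eq {N : ℕ} (φ : Fin N → DecisionRule Y)
    (P : Fin N → ProbabilityMeasure Y) : missedDetection φ P = 1 - falseAlarm φ P := by
  unfold missedDetection falseAlarm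
  have hm : MeasurableSet {y | lastDecision N φ y = true} :=
    measurable_lastDecision N φ (measurableSet_singleton true)
  rw [← probReal_compl_eq_one_sub hm]
  congr 1
  ext y
  simp

/-- Probability under `P` that a rule decides `true` after receiving the bit `b`. -/
def passProb (φ : DecisionRule Y) (P : ProbabilityMeasure Y) (b : Bool) : ℝ :=
  (P : Measure Y).real {y | φ.1 (y, b) = true}

lemma measurableSet_pass (φ : DecisionRule Y) (b : Bool) :
    MeasurableSet {y | φ.1 (y, b) = true} :=
  (φ.2.comp (measurable_id.prodMk measurable_const)) (measurableSet_singleton true)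

lemma falseAlarm_nonneg {N : ℕ} (φ : Fin N → DecisionRule Y)
    (P : Fin N → ProbabilityMeasure Y) : 0 ≤ falseAlarm φ P := measureReal_nonneg

lemma falseAlarm_le_one {N : ℕ} (φ : Fin N → DecisionRule Y)
    (P : Fin N → ProbabilityMeasure Y) : falseAlarm φ P ≤ 1 := measureReal_le_one

lemma falseAlarm_zero (φ : Fin 0 → DecisionRule Y) (P : Fin 0 → ProbabilityMeasure Y) :
    falseAlarm φ P = 0 := by
  simp [falseAlarm, lastDecision]

/-- The last observation is independent of the preceding decision. Since `P` is arbitrary, this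
serves under both hypotheses. -/
lemma falseAlarm_succ {N : ℕ} (φ : Fin (N + 1) → DecisionRule Y)
    (P : Fin (N + 1) → ProbabilityMeasure Y) :
    falseAlarm φ P =
      (1 - falseAlarm (fun k => φ k.castSucc) fun k => P k.castSucc) *
          passProb (φ (Fin.last N)) (P (Fin.last N)) false +
        (falseAlarm (fun k => φ k.castSucc) fun k => P k.castSucc) *
          passProb (φ (Fin.last N)) (P (Fin.last N)) true := by
  rw [← missedDetection_eq]
  set ψ : Fin N → DecisionRule Y := fun k => φ k.castSucc with hψ
  set D : Bool → Set (Fin N → Y) := fun b => {u | lastDecision N ψ u = b} with hD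
  set E : Bool → Set Y := fun b => {y | (φ (Fin.last N)).1 (y, b) = true} with hE
  have hDm (b : Bool) : MeasurableSet (D b) :=
    measurable_lastDecision N ψ (measurableSet_singleton b)
  have hEm (b : Bool) : MeasurableSet (E b) := measurableSet_pass _ b
  have hmp := measurePreserving_piFinSuccAbove (fun k => (P k : Measure Y)) (Fin.last N)
  have hset : {y | lastDecision (N + 1) φ y = true} =
      MeasurableEquiv.piFinSuccAbove (fun _ => Y) (Fin.last N) ⁻¹'
        (E false ×ˢ D false ∪ E true ×ˢ D true) := by
    ext y
    have h : (MeasurableEquiv.piFinSuccAbove (fun _ => Y) (Fin.last N)) y =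
        (y (Fin.last N), fun k => y k.castSucc) := by
      ext <;> simp [MeasurableEquiv.piFinSuccAbove, Fin.insertNthEquiv, Fin.init]
    rw [Set.mem_preimage, h]
    simp only [lastDecision, Set.mem_ofPred_eq, Set.mem_union, Set.mem_prod, hD, hE]
    change (φ (Fin.last N)).1 (_, lastDecision N ψ _) = true ↔ _
    cases lastDecision N ψ fun k => y k.castSucc <;> simp
  have hdisj : Disjoint (E false ×ˢ D false) (E true ×ˢ D true) := by
    rw [Set.disjoint_left]
    rintro ⟨y, u⟩ ⟨-, h₁⟩ ⟨-, h₂⟩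
    simp only [hD, Set.mem_ofPred_eq] at h₁ h₂
    simp [h₁] at h₂
  unfold falseAlarm missedDetection passProb
  rw [hset, measureReal_def, hmp.measure_preimage
    (((hEm _).prod (hDm _)).union ((hEm _).prod (hDm _))).nullMeasurableSet, ← measureReal_def,
    measureReal_union hdisj ((hEm _).prod (hDm _)), measureReal_prod_prod, measureReal_prod_prod]
  simp only [Fin.succAbove_last]
  ring

/-- Every agent negates its output and undoes its predecessor's negation. The first agent leaves its
input alone, as `U_0` is fixed; with no agents that constant could not be flipped. -/
lemma exists_flip {N : ℕ} (hN : N ≠ 0) (φ : Fin N → DecisionRule Y) :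
    ∃ ψ : Fin N → DecisionRule Y, ∀ y, lastDecision N ψ y = !lastDecision N φ y := by
  let ψ (M : ℕ) (φ : Fin M → DecisionRule Y) (k : Fin M) : DecisionRule Y :=
    ⟨fun p => !(φ k).1 (p.1, if (k : ℕ) = 0 then p.2 else !p.2), by
      refine (measurable_of_countable not).comp ((φ k).2.comp (measurable_fst.prodMk ?_))
      split_ifs
      · exact measurable_snd
      · exact (measurable_of_countable not).comp measurable_snd⟩
  refine ⟨ψ N φ, ?_⟩
  have key : ∀ (M : ℕ) (φ : Fin (M + 1) → DecisionRule Y) (y : Fin (M + 1) → Y),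
      lastDecision (M + 1) (ψ (M + 1) φ) y = !lastDecision (M + 1) φ y := by
    intro M
    induction M with
    | zero => intro φ y; simp [lastDecision, ψ]
    | succ M ih =>
      intro φ y
      have h := ih (fun k => φ k.castSucc) (fun k => y k.castSucc)
      rw [lastDecision]
      conv_rhs => rw [lastDecision]
      have h' : lastDecision (M + 1) (fun k => ψ (M + 1 + 1) φ k.castSucc)
          (fun k => y k.castSucc) = !lastDecision (M + 1) (fun k => φ k.castSucc)
          (fun k => y k.castSucc) := h
      rw [h']
      simp [ψ]
  obtain ⟨M, rfl⟩ := Nat.exists_eq_succ_of_ne_zero hN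
  exact key M φ

lemma errorProb_nonneg {π₀ π₁ : ℝ} (hπ₀ : 0 ≤ π₀) (hπ₁ : 0 ≤ π₁) {N : ℕ}
    (φ : Fin N → DecisionRule Y) (P₀ P₁ : Fin N → ProbabilityMeasure Y) :
    0 ≤ errorProb π₀ π₁ φ P₀ P₁ :=
  add_nonneg (mul_nonneg hπ₀ measureReal_nonneg) (mul_nonneg hπ₁ measureReal_nonneg)

lemma bddAbove_errorProb {π₀ π₁ : ℝ} (hπ₀ : 0 ≤ π₀) (hπ₁ : 0 ≤ π₁)
    (𝒫₀ 𝒫₁ : Set (ProbabilityMeasure Y)) {N : ℕ} (φ : Fin N → DecisionRule Y) :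
    BddAbove (Set.range fun P : (Fin N → 𝒫₀) × (Fin N → 𝒫₁) =>
      errorProb π₀ π₁ φ (fun k => (P.1 k : ProbabilityMeasure Y))
        (fun k => (P.2 k : ProbabilityMeasure Y))) := by
  refine ⟨π₀ * 1 + π₁ * 1, ?_⟩
  rintro _ ⟨P, rfl⟩
  exact add_le_add (mul_le_mul_of_nonneg_left measureReal_le_one hπ₀)
    (mul_le_mul_of_nonneg_left measureReal_le_one hπ₁)

lemma maxError_nonneg {π₀ π₁ : ℝ} (hπ₀ : 0 ≤ π₀) (hπ₁ : 0 ≤ π₁)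
    (𝒫₀ 𝒫₁ : Set (ProbabilityMeasure Y)) {N : ℕ} (φ : Fin N → DecisionRule Y) :
    0 ≤ maxError π₀ π₁ 𝒫₀ 𝒫₁ φ :=
  Real.iSup_nonneg fun _ => errorProb_nonneg hπ₀ hπ₁ _ _ _

lemma bddBelow_maxError {π₀ π₁ : ℝ} (hπ₀ : 0 ≤ π₀) (hπ₁ : 0 ≤ π₁)
    (𝒫₀ 𝒫₁ : Set (ProbabilityMeasure Y)) (N : ℕ) :
    BddBelow (Set.range fun φ : Fin N → DecisionRule Y => maxError π₀ π₁ 𝒫₀ 𝒫₁ φ) :=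
  ⟨0, by rintro _ ⟨φ, rfl⟩; exact maxError_nonneg hπ₀ hπ₁ _ _ _⟩

instance : Nonempty (DecisionRule Y) := ⟨⟨fun _ => false, measurable_const⟩⟩

end Recursion

/-! ### An invariant region for the error pair under bounded likelihood ratio. -/

section LowerBound

variable {Y : Type*} [MeasurableSpace Y]

/-- One step of a two-state chain under two laws whose likelihood ratio lies in `[1/C, C]` does not
decrease the sum of the error probabilities, once that sum is at most `1/C`. -/
lemma le_step_of_small {C x w p q r s : ℝ} (hC : 1 ≤ C) (hx : 0 ≤ x) (hw : 0 ≤ w)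
    (hp : 0 ≤ p) (hr : 0 ≤ r) (hqp : q ≤ C * p) (hrs : r ≤ C * s) (h : C * (x + w) ≤ 1) :
    x + w ≤ ((1 - x) * p + x * (1 - r)) + (w * (1 - q) + (1 - w) * s) := by
  -- The sum changes by `((1 - x) * p - w * q) + ((1 - w) * s - x * r)`; these bounds make both
  -- brackets nonnegative.
  have hCw : C * w ≤ 1 - x := by nlinarith
  have hCx : C * x ≤ 1 - w := by nlinarith
  have hs : 0 ≤ s := by nlinarith
  nlinarith [mul_le_mul_of_nonneg_left hqp hw, mul_le_mul_of_nonneg_left hrs hx,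
    mul_le_mul_of_nonneg_right hCw hp, mul_le_mul_of_nonneg_right hCx hs]

/-- Each received bit poses a binary test with weights `1 - x, w` or `x, 1 - w`. If `p` were `q`,
its error would average the weights, so be at least their minimum; the likelihood ratio bound costs
a factor `C`. The two minima add up to `min (x + w) (2 - x - w)`. -/
lemma div_le_step {C G x w p q p' q' : ℝ} (hC : 1 ≤ C)
    (hG₁ : G ≤ x + w) (hG₂ : G ≤ 2 - x - w) (hx : 0 ≤ x) (hx1 : x ≤ 1) (hw : 0 ≤ w) (hw1 : w ≤ 1)
    (hq : 0 ≤ q) (hq1 : q ≤ 1) (hq' : 0 ≤ q') (hq1' : q' ≤ 1)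
    (hqp : q ≤ C * p) (hqp' : q' ≤ C * p') :
    G ≤ C * (((1 - x) * p + x * p') + (w * (1 - q) + (1 - w) * (1 - q'))) := by
  have aux : ∀ {a b p q m : ℝ}, 0 ≤ a → 0 ≤ b → 0 ≤ q → q ≤ 1 → q ≤ C * p → m ≤ a → m ≤ b →
      m ≤ C * (a * p + b * (1 - q)) := by
    intro a b p q m ha hb hq hq1 hqp hma hmb
    nlinarith [mul_le_mul_of_nonneg_left hqp ha, mul_le_mul_of_nonneg_right hma hq,
      mul_le_mul_of_nonneg_right hmb (sub_nonneg.2 hq1), mul_nonneg hb (sub_nonneg.2 hq1),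
      mul_nonneg (sub_nonneg.2 hC) (mul_nonneg hb (sub_nonneg.2 hq1))]
  rcases le_total (x + w) 1 with h | h
  · have h₁ := aux (m := w) (sub_nonneg.2 hx1) hw hq hq1 hqp (by linarith) le_rfl
    have h₂ := aux (m := x) hx (sub_nonneg.2 hw1) hq' hq1' hqp' le_rfl (by linarith)
    nlinarith
  · have h₁ := aux (m := 1 - x) (sub_nonneg.2 hx1) hw hq hq1 hqp le_rfl (by linarith)
    have h₂ := aux (m := 1 - w) hx (sub_nonneg.2 hw1) hq' hq1' hqp' (by linarith) le_rfl
    nlinarith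

/-- The set of error pairs at distance at least `1/C²` from perfect (and from perfectly wrong)
detection is preserved by every step. -/
lemma inv_sq_le_step {C x w p q p' q' : ℝ} (hC : 1 ≤ C)
    (h₁ : (C ^ 2)⁻¹ ≤ x + w) (h₂ : (C ^ 2)⁻¹ ≤ 2 - x - w)
    (hx : 0 ≤ x) (hx1 : x ≤ 1) (hw : 0 ≤ w) (hw1 : w ≤ 1)
    (hp : 0 ≤ p) (hq : 0 ≤ q) (hp1 : p ≤ 1) (hq1 : q ≤ 1)
    (hp' : 0 ≤ p') (hq' : 0 ≤ q') (hp1' : p' ≤ 1) (hq1' : q' ≤ 1)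
    (hqp : q ≤ C * p) (hqp' : q' ≤ C * p')
    (hrs : 1 - p ≤ C * (1 - q)) (hrs' : 1 - p' ≤ C * (1 - q')) :
    (C ^ 2)⁻¹ ≤ ((1 - x) * p + x * p') + (w * (1 - q) + (1 - w) * (1 - q')) := by
  have hC0 : 0 < C := by linarith
  by_cases ha : C * (x + w) ≤ 1
  · have := le_step_of_small (r := 1 - p') (s := 1 - q') hC hx hw hp (by linarith) hqp hrs' ha
    linarith
  -- Near perfectly wrong detection, relabelling the received bit reduces to the previous case.
  by_cases hb : C * (2 - x - w) ≤ 1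
  · have := le_step_of_small (x := 1 - x) (w := 1 - w) (r := 1 - p) (s := 1 - q) hC
      (by linarith) (by linarith) hp' (by linarith) hqp' hrs (by linarith)
    linarith
  -- In the middle range both sums exceed `1/C`, and one step divides by at most `C`.
  have hG₁ : C⁻¹ ≤ x + w := by
    rw [inv_le_iff_one_le_mul₀ hC0]; linarith
  have hG₂ : C⁻¹ ≤ 2 - x - w := by
    rw [inv_le_iff_one_le_mul₀ hC0]; linarith
  have := div_le_step hC hG₁ hG₂ hx hx1 hw hw1 hq hq1 hq' hq1' hqp hqp'
  calc (C ^ 2)⁻¹ = C⁻¹ * C⁻¹ := by rw [sq, mul_inv]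
    _ ≤ C⁻¹ * (C * _) := mul_le_mul_of_nonneg_left this (by positivity)
    _ = _ := by rw [inv_mul_cancel_left₀ hC0.ne']

/-- The second bound is needed for the induction: an agent may invert the bit it receives, turning
perfectly wrong decisions into correct ones. -/
lemma falseAlarm_add_missedDetection_bounds {Q₀ Q₁ : ProbabilityMeasure Y} {C : ℝ} (hC : 1 ≤ C)
    (h₁₀ : ∀ A, MeasurableSet A → (Q₁ : Measure Y).real A ≤ C * (Q₀ : Measure Y).real A)
    (h₀₁ : ∀ A, MeasurableSet A → (Q₀ : Measure Y).real A ≤ C * (Q₁ : Measure Y).real A) :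
    ∀ (N : ℕ) (φ : Fin N → DecisionRule Y),
      (C ^ 2)⁻¹ ≤ falseAlarm φ (fun _ => Q₀) + (1 - falseAlarm φ fun _ => Q₁) ∧
      (C ^ 2)⁻¹ ≤ 2 - falseAlarm φ (fun _ => Q₀) - (1 - falseAlarm φ fun _ => Q₁) := by
  intro N
  induction N with
  | zero =>
    intro φ
    have : (C ^ 2)⁻¹ ≤ 1 := inv_le_one_of_one_le₀ (one_le_pow₀ hC)
    simp only [falseAlarm_zero]
    constructor <;> linarith
  | succ N ih =>
    intro φ
    obtain ⟨h₁, h₂⟩ := ih fun k => φ k.castSucc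
    rw [falseAlarm_succ, falseAlarm_succ]
    have hx := falseAlarm_nonneg (fun k : Fin N => φ k.castSucc) fun _ => Q₀
    have hx1 := falseAlarm_le_one (fun k : Fin N => φ k.castSucc) fun _ => Q₀
    have hw := falseAlarm_nonneg (fun k : Fin N => φ k.castSucc) fun _ => Q₁
    have hw1 := falseAlarm_le_one (fun k : Fin N => φ k.castSucc) fun _ => Q₁
    set x := falseAlarm (fun k : Fin N => φ k.castSucc) fun _ => Q₀
    set z := falseAlarm (fun k : Fin N => φ k.castSucc) fun _ => Q₁
    set f := φ (Fin.last N)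
    have n (Q : ProbabilityMeasure Y) (b : Bool) : 0 ≤ passProb f Q b := measureReal_nonneg
    have l (Q : ProbabilityMeasure Y) (b : Bool) : passProb f Q b ≤ 1 := measureReal_le_one
    have r₁ (b : Bool) : passProb f Q₁ b ≤ C * passProb f Q₀ b := h₁₀ _ (measurableSet_pass f b)
    have r₀ (b : Bool) : passProb f Q₀ b ≤ C * passProb f Q₁ b := h₀₁ _ (measurableSet_pass f b)
    have c (Q : ProbabilityMeasure Y) (b : Bool) : 1 - passProb f Q b =
        (Q : Measure Y).real {y | f.1 (y, b) = true}ᶜ :=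
      (probReal_compl_eq_one_sub (measurableSet_pass f b)).symm
    have s₁ (b : Bool) : 1 - passProb f Q₁ b ≤ C * (1 - passProb f Q₀ b) := by
      rw [c, c]; exact h₁₀ _ (measurableSet_pass f b).compl
    have s₀ (b : Bool) : 1 - passProb f Q₀ b ≤ C * (1 - passProb f Q₁ b) := by
      rw [c, c]; exact h₀₁ _ (measurableSet_pass f b).compl
    constructor
    · have := inv_sq_le_step hC h₁ h₂ hx hx1 (by linarith) (by linarith) (n Q₀ false) (n Q₁ false)
        (l Q₀ false) (l Q₁ false) (n Q₀ true) (n Q₁ true) (l Q₀ true) (l Q₁ true)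
        (r₁ false) (r₁ true) (s₀ false) (s₀ true)
      linarith
    -- Negating the agent's output replaces the new error sum by `2` minus it.
    · have := inv_sq_le_step (p := 1 - passProb f Q₀ false) (q := 1 - passProb f Q₁ false)
        (p' := 1 - passProb f Q₀ true) (q' := 1 - passProb f Q₁ true) hC h₁ h₂ hx hx1
        (by linarith) (by linarith)
        (by linarith [l Q₀ false]) (by linarith [l Q₁ false])
        (by linarith [n Q₀ false]) (by linarith [n Q₁ false])
        (by linarith [l Q₀ true]) (by linarith [l Q₁ true])
        (by linarith [n Q₀ true]) (by linarith [n Q₁ true])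
        (s₁ false) (s₁ true) (by linarith [r₀ false]) (by linarith [r₀ true])
      linarith

/-- If the two classes contain distributions with likelihood ratio bounded away from `0` and `∞`,
the minimax error is bounded away from `0`. -/
lemma exists_pos_le_minimaxError {π₀ π₁ : ℝ} (hπ₀ : 0 < π₀) (hπ₁ : 0 < π₁)
    {𝒫₀ 𝒫₁ : Set (ProbabilityMeasure Y)} {Q₀ Q₁ : ProbabilityMeasure Y} (hQ₀ : Q₀ ∈ 𝒫₀)
    (hQ₁ : Q₁ ∈ 𝒫₁) {C : ℝ} (hC : 1 ≤ C)
    (h₁₀ : ∀ A, MeasurableSet A → (Q₁ : Measure Y).real A ≤ C * (Q₀ : Measure Y).real A)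
    (h₀₁ : ∀ A, MeasurableSet A → (Q₀ : Measure Y).real A ≤ C * (Q₁ : Measure Y).real A) :
    ∃ c : ℝ, 0 < c ∧ ∀ N, c ≤ minimaxError π₀ π₁ 𝒫₀ 𝒫₁ N := by
  have hm : 0 < min π₀ π₁ := lt_min hπ₀ hπ₁
  refine ⟨min π₀ π₁ * (C ^ 2)⁻¹, by positivity, fun N => le_ciInf fun φ => ?_⟩
  refine le_trans ?_ (le_ciSup (bddAbove_errorProb hπ₀.le hπ₁.le 𝒫₀ 𝒫₁ φ)
    (fun _ => ⟨Q₀, hQ₀⟩, fun _ => ⟨Q₁, hQ₁⟩))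
  simp only [errorProb, missedDetection_eq]
  have h := (falseAlarm_add_missedDetection_bounds hC h₁₀ h₀₁ N φ).1
  have hx := falseAlarm_nonneg φ fun _ => Q₀
  have hw := falseAlarm_le_one φ fun _ => Q₁
  calc min π₀ π₁ * (C ^ 2)⁻¹ ≤ min π₀ π₁ * _ := mul_le_mul_of_nonneg_left h hm.le
    _ = min π₀ π₁ * _ + min π₀ π₁ * _ := mul_add _ _ _
    _ ≤ _ := add_le_add (mul_le_mul_of_nonneg_right (min_le_left _ _) hx)
      (mul_le_mul_of_nonneg_right (min_le_right _ _) (by linarith))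

end LowerBound

/-! ### Contamination classes and the least favourable mixtures. -/

section Contamination

variable {Y : Type*} [MeasurableSpace Y]

lemma real_mixture {ε : ℝ} (hε : ε ∈ Set.Ico (0 : ℝ) 1) (P R : ProbabilityMeasure Y) (A : Set Y) :
    (ENNReal.ofReal (1 - ε) • (P : Measure Y) + ENNReal.ofReal ε • (R : Measure Y)).real A =
      (1 - ε) * (P : Measure Y).real A + ε * (R : Measure Y).real A := by
  have hf (c : ℝ) (S : ProbabilityMeasure Y) : (ENNReal.ofReal c • (S : Measure Y)) A ≠ ⊤ := by
    rw [Measure.smul_apply, smul_eq_mul]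
    exact ENNReal.mul_ne_top ENNReal.ofReal_ne_top (measure_ne_top _ _)
  rw [measureReal_add_apply (hf _ _) (hf _ _), measureReal_ennreal_smul_apply,
    measureReal_ennreal_smul_apply, ENNReal.toReal_ofReal (by linarith [hε.2]),
    ENNReal.toReal_ofReal hε.1]

lemma real_of_mem_contaminationClass {ε : ℝ} (hε : ε ∈ Set.Ico (0 : ℝ) 1)
    {P Q : ProbabilityMeasure Y} (hQ : Q ∈ contaminationClass ε P) :
    ∃ R : ProbabilityMeasure Y, ∀ A, (Q : Measure Y).real A =
      (1 - ε) * (P : Measure Y).real A + ε * (R : Measure Y).real A := by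
  obtain ⟨R, hR⟩ := hQ
  exact ⟨R, fun A => by rw [hR, real_mixture hε]⟩

lemma exists_mem_contaminationClass {ε : ℝ} (hε : ε ∈ Set.Ico (0 : ℝ) 1)
    (P R : ProbabilityMeasure Y) : ∃ Q ∈ contaminationClass ε P, ∀ A, (Q : Measure Y).real A =
      (1 - ε) * (P : Measure Y).real A + ε * (R : Measure Y).real A := by
  have hp : IsProbabilityMeasure
      (ENNReal.ofReal (1 - ε) • (P : Measure Y) + ENNReal.ofReal ε • (R : Measure Y)) := by
    constructor
    simp only [Measure.add_apply, Measure.smul_apply, measure_univ, smul_eq_mul, mul_one]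
    rw [← ENNReal.ofReal_add (by linarith [hε.2]) hε.1]
    simp
  exact ⟨⟨_, hp⟩, ⟨R, rfl⟩, real_mixture hε P R⟩

lemma eq_of_mem_contaminationClass_zero {P Q : ProbabilityMeasure Y}
    (hQ : Q ∈ contaminationClass 0 P) : Q = P := by
  obtain ⟨R, hR⟩ := hQ
  apply Subtype.ext
  simpa using hR

lemma mul_real_le_of_mem_contaminationClass {ε : ℝ} (hε : ε ∈ Set.Ico (0 : ℝ) 1)
    {P Q : ProbabilityMeasure Y} (hQ : Q ∈ contaminationClass ε P) (A : Set Y) :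
    (1 - ε) * (P : Measure Y).real A ≤ (Q : Measure Y).real A := by
  obtain ⟨R, hR⟩ := real_of_mem_contaminationClass hε hQ
  rw [hR]
  exact le_add_of_nonneg_right (mul_nonneg hε.1 measureReal_nonneg)

lemma nonempty_contaminationClass {ε : ℝ} (hε : ε ∈ Set.Ico (0 : ℝ) 1)
    (P : ProbabilityMeasure Y) : (contaminationClass ε P).Nonempty :=
  let ⟨Q, hQ, _⟩ := exists_mem_contaminationClass hε P P
  ⟨Q, hQ⟩

/-- If each nominal distribution is dominated by a multiple of the other one, or that other one is
contaminated, then the two classes contain distributions with bounded mutual likelihood ratio. -/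
lemma exists_dominated_pair {ε₀ ε₁ : ℝ} (hε₀ : ε₀ ∈ Set.Ico (0 : ℝ) 1)
    (hε₁ : ε₁ ∈ Set.Ico (0 : ℝ) 1) {P₀ P₁ : ProbabilityMeasure Y}
    (h₁₀ : 0 < ε₀ ∨ ∃ C : ℝ, ∀ A, MeasurableSet A →
      (P₁ : Measure Y).real A ≤ C * (P₀ : Measure Y).real A)
    (h₀₁ : 0 < ε₁ ∨ ∃ C : ℝ, ∀ A, MeasurableSet A →
      (P₀ : Measure Y).real A ≤ C * (P₁ : Measure Y).real A) :
    ∃ Q₀ ∈ contaminationClass ε₀ P₀, ∃ Q₁ ∈ contaminationClass ε₁ P₁, ∃ C : ℝ, 1 ≤ C ∧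
      (∀ A, MeasurableSet A → (Q₁ : Measure Y).real A ≤ C * (Q₀ : Measure Y).real A) ∧
      (∀ A, MeasurableSet A → (Q₀ : Measure Y).real A ≤ C * (Q₁ : Measure Y).real A) := by
  -- It suffices that the mixture on the right dominates both `P` and `P'`: `P` because `1 - ε > 0`,
  -- and `P'` either directly through `ε > 0` or through `P`.
  have key : ∀ {ε ε' : ℝ}, ε ∈ Set.Ico (0 : ℝ) 1 → ε' ∈ Set.Ico (0 : ℝ) 1 →
      ∀ {P P' : ProbabilityMeasure Y}, (0 < ε ∨ ∃ C : ℝ, ∀ A, MeasurableSet A →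
        (P' : Measure Y).real A ≤ C * (P : Measure Y).real A) →
      ∃ C : ℝ, ∀ A, MeasurableSet A →
        (1 - ε') * (P' : Measure Y).real A + ε' * (P : Measure Y).real A ≤
        C * ((1 - ε) * (P : Measure Y).real A + ε * (P' : Measure Y).real A) := by
    intro ε ε' hε hε' P P' h
    have h1 : 0 < 1 - ε := by linarith [hε.2]
    have h1' : 0 < 1 - ε' := by linarith [hε'.2]
    obtain ⟨C, hC0, hC⟩ : ∃ C : ℝ, 0 ≤ C ∧ ∀ A, MeasurableSet A → (P' : Measure Y).real A ≤
        C * ((1 - ε) * (P : Measure Y).real A + ε * (P' : Measure Y).real A) := by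
      rcases h with h | ⟨C, hC⟩
      · refine ⟨ε⁻¹, by positivity, fun A _ => ?_⟩
        rw [mul_add, inv_mul_cancel_left₀ h.ne']
        exact le_add_of_nonneg_left (by positivity)
      · refine ⟨|C| * (1 - ε)⁻¹, by positivity, fun A hA => ?_⟩
        calc _ ≤ C * (P : Measure Y).real A := hC A hA
          _ ≤ |C| * (P : Measure Y).real A := by gcongr; exact le_abs_self C
          _ = |C| * (1 - ε)⁻¹ * ((1 - ε) * (P : Measure Y).real A) := by
            field_simp
          _ ≤ _ := by
            gcongr
            exact le_add_of_nonneg_right (mul_nonneg hε.1 measureReal_nonneg)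
    refine ⟨C + (1 - ε)⁻¹, fun A hA => ?_⟩
    have hP : (P : Measure Y).real A ≤
        (1 - ε)⁻¹ * ((1 - ε) * (P : Measure Y).real A + ε * (P' : Measure Y).real A) := by
      rw [mul_add, inv_mul_cancel_left₀ h1.ne']
      exact le_add_of_nonneg_right (mul_nonneg (by positivity)
        (mul_nonneg hε.1 measureReal_nonneg))
    rw [add_mul]
    have n : 0 ≤ (P : Measure Y).real A := measureReal_nonneg
    have n' : 0 ≤ (P' : Measure Y).real A := measureReal_nonneg
    exact add_le_add ((mul_le_of_le_one_left n' (by linarith [hε'.1])).trans (hC A hA))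
      ((mul_le_of_le_one_left n hε'.2.le).trans hP)
  obtain ⟨Q₀, hQ₀, e₀⟩ := exists_mem_contaminationClass hε₀ P₀ P₁
  obtain ⟨Q₁, hQ₁, e₁⟩ := exists_mem_contaminationClass hε₁ P₁ P₀
  obtain ⟨C, hC⟩ := key hε₀ hε₁ h₁₀
  obtain ⟨C', hC'⟩ := key hε₁ hε₀ h₀₁
  refine ⟨Q₀, hQ₀, Q₁, hQ₁, max 1 (max C C'), le_max_left _ _, fun A hA => ?_, fun A hA => ?_⟩
  · calc _ ≤ C * (Q₀ : Measure Y).real A := by rw [e₀, e₁]; exact hC A hA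
      _ ≤ _ := by gcongr; exact (le_max_left _ _).trans (le_max_right _ _)
  · calc _ ≤ C' * (Q₁ : Measure Y).real A := by rw [e₀, e₁]; exact hC' A hA
      _ ≤ _ := by gcongr; exact (le_max_right _ _).trans (le_max_right _ _)

end Contamination

/-! ### Essential bounds on the log-likelihood ratio as comparisons of measures. -/

section LikelihoodRatio

variable {Y : Type*} [MeasurableSpace Y] {μ ν : Measure Y} [IsProbabilityMeasure μ]
  [IsProbabilityMeasure ν]

lemma exists_real_le_of_llr_bddAbove (h : μ ≪ ν) (h' : ν ≪ μ)
    (hb : IsBoundedUnder (· ≤ ·) (ae ν) (llr μ ν)) :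
    ∃ C : ℝ, ∀ A, MeasurableSet A → μ.real A ≤ C * ν.real A := by
  obtain ⟨b, hb⟩ := hb
  refine ⟨Real.exp b, fun A hA => ?_⟩
  rw [← Measure.setIntegral_toReal_rnDeriv h, mul_comm, ← smul_eq_mul, ← setIntegral_const]
  refine setIntegral_mono_ae Measure.integrable_toReal_rnDeriv.integrableOn
    (integrable_const _).integrableOn ?_
  filter_upwards [eventually_map.1 hb, Measure.rnDeriv_pos' h', μ.rnDeriv_lt_top ν]
    with y hy hpos htop
  exact (Real.log_le_iff_le_exp (ENNReal.toReal_pos hpos.ne' htop.ne)).1 hy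

lemma exists_real_le_of_llr_bddBelow (h : μ ≪ ν) (h' : ν ≪ μ)
    (hb : IsBoundedUnder (· ≥ ·) (ae ν) (llr μ ν)) :
    ∃ C : ℝ, ∀ A, MeasurableSet A → ν.real A ≤ C * μ.real A := by
  obtain ⟨b, hb⟩ := hb
  refine ⟨Real.exp (-b), fun A hA => ?_⟩
  have key : ν.real A * Real.exp b ≤ μ.real A := by
    rw [← Measure.setIntegral_toReal_rnDeriv h, ← smul_eq_mul, ← setIntegral_const]
    refine setIntegral_mono_ae (integrable_const _).integrableOn
      Measure.integrable_toReal_rnDeriv.integrableOn ?_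
    filter_upwards [eventually_map.1 hb, Measure.rnDeriv_pos' h', μ.rnDeriv_lt_top ν]
      with y hy hpos htop
    exact (Real.le_log_iff_exp_le (ENNReal.toReal_pos hpos.ne' htop.ne)).1 hy
  rw [Real.exp_neg, inv_mul_eq_div, le_div_iff₀ (Real.exp_pos b)]
  exact key

lemma exists_real_ge_of_llr_not_bddAbove (h : μ ≪ ν) (h' : ν ≪ μ)
    (hb : ¬ IsBoundedUnder (· ≤ ·) (ae ν) (llr μ ν)) (K : ℝ) (hK : 0 < K) :
    ∃ A, MeasurableSet A ∧ 0 < ν.real A ∧ K * ν.real A ≤ μ.real A := by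
  refine ⟨{y | Real.log K < llr μ ν y}, measurableSet_lt measurable_const (measurable_llr μ ν),
    ?_, ?_⟩
  · rw [measureReal_def, ENNReal.toReal_pos_iff]
    refine ⟨pos_iff_ne_zero.2 fun h0 => hb ⟨Real.log K, ?_⟩, measure_lt_top _ _⟩
    rw [eventually_map, ae_iff]
    simpa using h0
  · rw [← Measure.setIntegral_toReal_rnDeriv h, mul_comm, ← smul_eq_mul, ← setIntegral_const]
    refine setIntegral_mono_on_ae (integrable_const _).integrableOn
      Measure.integrable_toReal_rnDeriv.integrableOn
      (measurableSet_lt measurable_const (measurable_llr μ ν)) ?_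
    filter_upwards [Measure.rnDeriv_pos' h', μ.rnDeriv_lt_top ν] with y hpos htop hy
    exact ((Real.log_lt_log_iff hK (ENNReal.toReal_pos hpos.ne' htop.ne)).1 hy).le

/-- Exchanging the two measures negates the log-likelihood ratio, and mutual absolute continuity
gives them the same null sets. -/
lemma exists_real_ge_of_llr_not_bddBelow (h : μ ≪ ν) (h' : ν ≪ μ)
    (hb : ¬ IsBoundedUnder (· ≥ ·) (ae ν) (llr μ ν)) (K : ℝ) (hK : 0 < K) :
    ∃ A, MeasurableSet A ∧ 0 < μ.real A ∧ K * μ.real A ≤ ν.real A := by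
  refine exists_real_ge_of_llr_not_bddAbove h' h (fun ⟨b, hbb⟩ => hb ⟨-b, ?_⟩) K hK
  rw [eventually_map] at hbb ⊢
  filter_upwards [h'.ae_le hbb, neg_llr h'] with y hy hn
  simp only [Pi.neg_apply] at hn
  linarith

end LikelihoodRatio

/-! ### Tandems with vanishing error: alarm, then relay. -/

section UpperBound

variable {Y : Type*} [MeasurableSpace Y]

open Classical in
/-- The rule that raises an alarm when the observation lies in `A`, and keeps an alarm raised
before. -/
noncomputable def alarmRule (A : Set Y) (hA : MeasurableSet A) : DecisionRule Y :=
  ⟨fun p => p.2 || decide (p.1 ∈ A), by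
    have h : Measurable fun y => decide (y ∈ A) :=
      measurable_to_bool (by simpa [Set.preimage] using hA)
    exact (measurable_of_countable fun b : Bool × Bool => b.1 || b.2).comp
      (measurable_snd.prodMk (h.comp measurable_fst))⟩

/-- The rule that forwards the received decision. -/
def relayRule : DecisionRule Y := ⟨Prod.snd, measurable_snd⟩

lemma passProb_alarmRule (A : Set Y) (hA : MeasurableSet A) (P : ProbabilityMeasure Y) :
    passProb (alarmRule A hA) P true = 1 ∧
      passProb (alarmRule A hA) P false = (P : Measure Y).real A := by
  simp [passProb, alarmRule]

lemma passProb_relayRule (P : ProbabilityMeasure Y) :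
    passProb relayRule P true = 1 ∧ passProb relayRule P false = 0 := by
  simp [passProb, relayRule]

/-- The first `M` agents use the alarm rule, the others relay. -/
noncomputable def alarmThenRelay (A : Set Y) (hA : MeasurableSet A) (M : ℕ) (k : ℕ) : DecisionRule Y :=
  if k < M then alarmRule A hA else relayRule

lemma falseAlarm_alarmThenRelay_succ (A : Set Y) (hA : MeasurableSet A) (M N : ℕ)
    (P : Fin (N + 1) → ProbabilityMeasure Y) :
    falseAlarm (fun k : Fin (N + 1) => alarmThenRelay A hA M k) P =
      (falseAlarm (fun k : Fin N => alarmThenRelay A hA M k) fun k => P k.castSucc) +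
      if N < M then
        (1 - falseAlarm (fun k : Fin N => alarmThenRelay A hA M k) fun k => P k.castSucc) *
          (P (Fin.last N) : Measure Y).real A else 0 := by
  rw [falseAlarm_succ]
  simp only [Fin.val_castSucc, Fin.val_last]
  by_cases h : N < M
  · rw [if_pos h, show alarmThenRelay A hA M N = alarmRule A hA from if_pos h,
      (passProb_alarmRule A hA _).1, (passProb_alarmRule A hA _).2]
    ring
  · rw [if_neg h, show alarmThenRelay A hA M N = relayRule from if_neg h,
      (passProb_relayRule _).1, (passProb_relayRule _).2]
    ring

lemma falseAlarm_alarmThenRelay_le (A : Set Y) (hA : MeasurableSet A) (M : ℕ)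
    (Q : ProbabilityMeasure Y) (N : ℕ) :
    falseAlarm (fun k : Fin N => alarmThenRelay A hA M k) (fun _ => Q) ≤
      (min N M : ℕ) * (Q : Measure Y).real A := by
  induction N with
  | zero => simp [falseAlarm_zero]
  | succ N ih =>
    rw [falseAlarm_alarmThenRelay_succ]
    have n := falseAlarm_nonneg (fun k : Fin N => alarmThenRelay A hA M k) (fun _ => Q)
    have a : 0 ≤ (Q : Measure Y).real A := measureReal_nonneg
    by_cases h : N < M
    · rw [if_pos h, min_eq_left (Nat.succ_le_of_lt h)]
      rw [min_eq_left h.le] at ih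
      push_cast
      nlinarith
    · rw [if_neg h, min_eq_right (by omega)]
      rw [min_eq_right (by omega)] at ih
      linarith

lemma missedDetection_alarmThenRelay_le (A : Set Y) (hA : MeasurableSet A) (M : ℕ)
    {c : ℝ} (hc1 : c ≤ 1) (N : ℕ) (P : Fin N → ProbabilityMeasure Y)
    (hP : ∀ k, c ≤ (P k : Measure Y).real A) :
    missedDetection (fun k : Fin N => alarmThenRelay A hA M k) P ≤ (1 - c) ^ min N M := by
  rw [missedDetection_eq]
  induction N with
  | zero => simp [falseAlarm_zero]
  | succ N ih =>
    rw [falseAlarm_alarmThenRelay_succ]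
    have ih := ih (fun k => P k.castSucc) fun k => hP _
    have n := falseAlarm_le_one (fun k : Fin N => alarmThenRelay A hA M k) fun k => P k.castSucc
    have a := hP (Fin.last N)
    by_cases h : N < M
    · rw [if_pos h, min_eq_left (Nat.succ_le_of_lt h), pow_succ]
      rw [min_eq_left h.le] at ih
      nlinarith [mul_le_mul_of_nonneg_right ih (sub_nonneg.2 hc1)]
    · rw [if_neg h, min_eq_right (by omega)]
      rw [min_eq_right (by omega)] at ih
      linarith

/-- If `R` puts arbitrarily larger mass than `Q` on suitable sets, then `Q` can be told from the
contamination class of `R` with arbitrarily small error probabilities. -/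
lemma exists_rule_of_unbounded {Q R : ProbabilityMeasure Y} {ε : ℝ} (hε : ε ∈ Set.Ico (0 : ℝ) 1)
    (h : ∀ K : ℝ, 0 < K → ∃ A, MeasurableSet A ∧ 0 < (Q : Measure Y).real A ∧
      K * (Q : Measure Y).real A ≤ (R : Measure Y).real A) {δ : ℝ} (hδ : 0 < δ) :
    ∃ M : ℕ, ∀ N, M ≤ N → ∃ φ : Fin N → DecisionRule Y, falseAlarm φ (fun _ => Q) ≤ δ ∧
      ∀ P : Fin N → ProbabilityMeasure Y, (∀ k, P k ∈ contaminationClass ε R) →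
        missedDetection φ P ≤ δ := by
  have h1 : 0 < 1 - ε := by linarith [hε.2]
  -- Chosen so that `(1 - ε) * (δ * K - 1) = δ⁻¹`, the exponent wanted below; the `+ 1` pays for
  -- rounding down the number of alarm agents.
  set K := ((1 - ε)⁻¹ * δ⁻¹ + 1) / δ with hK
  obtain ⟨A, hA, ha, hr⟩ := h K (by positivity)
  set a := (Q : Measure Y).real A
  set r := (R : Measure Y).real A
  have hr1 : r ≤ 1 := measureReal_le_one
  -- The largest number of alarm agents for which the union bound keeps false alarms below `δ`.
  refine ⟨⌊δ / a⌋₊, fun N hN => ⟨fun k => alarmThenRelay A hA ⌊δ / a⌋₊ k, ?_, fun P hP => ?_⟩⟩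
  · refine (falseAlarm_alarmThenRelay_le A hA _ Q N).trans ?_
    rw [min_eq_right hN]
    exact (le_div_iff₀ ha).1 (Nat.floor_le (by positivity))
  · have hc1 : (1 - ε) * r ≤ 1 := 
      mul_le_one₀ (by linarith [hε.1]) measureReal_nonneg hr1
    refine (missedDetection_alarmThenRelay_le A hA _ hc1 N P fun k =>
      mul_real_le_of_mem_contaminationClass hε (hP k) A).trans ?_
    rw [min_eq_right hN]
    have hM : δ / a - 1 ≤ (⌊δ / a⌋₊ : ℝ) := (Nat.sub_one_lt_floor _).le
    have hKa : δ * K - 1 ≤ (⌊δ / a⌋₊ : ℝ) * r := by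
      have hK0 : 0 < K := by positivity
      -- Uses `K * a ≤ r ≤ 1`.
      calc δ * K - 1 ≤ δ * K - K * a := by linarith
        _ = (δ / a - 1) * (K * a) := by field_simp
        _ ≤ (⌊δ / a⌋₊ : ℝ) * (K * a) := by gcongr
        _ ≤ _ := by gcongr
    have hexp : δ⁻¹ ≤ (⌊δ / a⌋₊ : ℝ) * ((1 - ε) * r) := by
      have e : (1 - ε) * (δ * K - 1) = δ⁻¹ := by
        rw [hK]; field_simp; ring
      calc δ⁻¹ = (1 - ε) * (δ * K - 1) := e.symm
        _ ≤ (1 - ε) * ((⌊δ / a⌋₊ : ℝ) * r) := by gcongr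
        _ = _ := by ring
    calc (1 - (1 - ε) * r) ^ ⌊δ / a⌋₊ ≤ (Real.exp (-((1 - ε) * r))) ^ ⌊δ / a⌋₊ :=
          pow_le_pow_left₀ (by linarith) (Real.one_sub_le_exp_neg _) _
      _ = Real.exp (-((⌊δ / a⌋₊ : ℝ) * ((1 - ε) * r))) := by
          rw [← Real.exp_nat_mul]; ring_nf
      _ ≤ Real.exp (-δ⁻¹) := Real.exp_le_exp.2 (neg_le_neg hexp)
      _ ≤ δ := by
          rw [Real.exp_neg]
          exact inv_le_of_inv_le₀ hδ (by linarith [Real.add_one_le_exp δ⁻¹])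

lemma tendsto_minimaxError_zero {π₀ π₁ : ℝ} (hπ₀ : 0 ≤ π₀) (hπ₁ : 0 ≤ π₁) (hπ : π₀ + π₁ = 1)
    {𝒫₀ 𝒫₁ : Set (ProbabilityMeasure Y)} (hn₀ : 𝒫₀.Nonempty) (hn₁ : 𝒫₁.Nonempty)
    (h : ∀ δ : ℝ, 0 < δ → ∃ M : ℕ, ∀ N, M ≤ N → ∃ φ : Fin N → DecisionRule Y,
      (∀ P : Fin N → ProbabilityMeasure Y, (∀ k, P k ∈ 𝒫₀) → falseAlarm φ P ≤ δ) ∧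
      ∀ P : Fin N → ProbabilityMeasure Y, (∀ k, P k ∈ 𝒫₁) → missedDetection φ P ≤ δ) :
    Tendsto (fun N : ℕ => minimaxError π₀ π₁ 𝒫₀ 𝒫₁ N) atTop (𝓝 0) := by
  rw [Metric.tendsto_atTop]
  intro δ hδ
  obtain ⟨M, hM⟩ := h (δ / 2) (by positivity)
  refine ⟨M, fun N hN => ?_⟩
  obtain ⟨φ, h₀, h₁⟩ := hM N hN
  have := hn₀.to_subtype
  have := hn₁.to_subtype
  have hnn : 0 ≤ minimaxError π₀ π₁ 𝒫₀ 𝒫₁ N :=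
    Real.iInf_nonneg fun φ => maxError_nonneg hπ₀ hπ₁ _ _ φ
  rw [Real.dist_eq, sub_zero, abs_of_nonneg hnn]
  refine lt_of_le_of_lt ((ciInf_le (bddBelow_maxError hπ₀ hπ₁ 𝒫₀ 𝒫₁ N) φ).trans
    (ciSup_le fun P => ?_)) (half_lt_self hδ)
  calc _ ≤ π₀ * (δ / 2) + π₁ * (δ / 2) := add_le_add
        (mul_le_mul_of_nonneg_left (h₀ _ fun k => (P.1 k).2) hπ₀)
        (mul_le_mul_of_nonneg_left (h₁ _ fun k => (P.2 k).2) hπ₁)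
    _ = δ / 2 := by rw [← add_mul, hπ, one_mul]

end UpperBound

/-! ### The characterization. -/

/-- The minimax error of a tandem network vanishes asymptotically exactly when one nominal
distribution is uncontaminated and the likelihood ratio is unbounded in the matching direction. -/
theorem tendsto_minimaxError_zero_iff {Y : Type*} [MeasurableSpace Y]
    (P₀ P₁ : ProbabilityMeasure Y)
    (h₀₁ : (P₀ : Measure Y) ≪ (P₁ : Measure Y)) (h₁₀ : (P₁ : Measure Y) ≪ (P₀ : Measure Y))
    (ε₀ ε₁ : ℝ) (hε₀ : ε₀ ∈ Set.Ico (0 : ℝ) 1) (hε₁ : ε₁ ∈ Set.Ico (0 : ℝ) 1)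
    (π₀ π₁ : ℝ) (hπ₀ : 0 < π₀) (hπ₁ : 0 < π₁) (hπ : π₀ + π₁ = 1) :
    Tendsto (fun N : ℕ => minimaxError π₀ π₁ (contaminationClass ε₀ P₀)
          (contaminationClass ε₁ P₁) N) atTop (𝓝 0) ↔
      (ε₀ = 0 ∧ ¬ IsBoundedUnder (· ≤ ·) (ae (P₀ : Measure Y))
          (llr (P₁ : Measure Y) (P₀ : Measure Y))) ∨
      (ε₁ = 0 ∧ ¬ IsBoundedUnder (· ≥ ·) (ae (P₀ : Measure Y))
          (llr (P₁ : Measure Y) (P₀ : Measure Y))) := by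
  constructor
  · intro ht
    by_contra! hcon
    obtain ⟨hab, hbe⟩ := hcon
    obtain ⟨Q₀, hQ₀, Q₁, hQ₁, C, hC, h₁, h₂⟩ := exists_dominated_pair hε₀ hε₁
      (hε₀.1.eq_or_lt.symm.imp_right fun h =>
        exists_real_le_of_llr_bddAbove h₁₀ h₀₁ (hab h.symm))
      (hε₁.1.eq_or_lt.symm.imp_right fun h =>
        exists_real_le_of_llr_bddBelow h₁₀ h₀₁ (hbe h.symm))
    obtain ⟨c, hc, hle⟩ := exists_pos_le_minimaxError hπ₀ hπ₁ hQ₀ hQ₁ hC h₁ h₂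
    exact hc.not_ge (ge_of_tendsto' ht hle)
  · intro h
    refine tendsto_minimaxError_zero hπ₀.le hπ₁.le hπ (nonempty_contaminationClass hε₀ P₀)
      (nonempty_contaminationClass hε₁ P₁) fun δ hδ => ?_
    rcases h with ⟨rfl, hb⟩ | ⟨rfl, hb⟩
    · obtain ⟨M, hM⟩ := exists_rule_of_unbounded hε₁
        (exists_real_ge_of_llr_not_bddAbove h₁₀ h₀₁ hb) hδ
      refine ⟨M, fun N hN => ?_⟩
      obtain ⟨φ, h₀, h₁⟩ := hM N hN
      refine ⟨φ, fun P hP => ?_, h₁⟩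
      rwa [show P = fun _ => P₀ from funext fun k => eq_of_mem_contaminationClass_zero (hP k)]
    · obtain ⟨M, hM⟩ := exists_rule_of_unbounded hε₀
        (exists_real_ge_of_llr_not_bddBelow h₁₀ h₀₁ hb) hδ
      -- The extra agent guarantees `N ≠ 0`, so that the decision can be flipped.
      refine ⟨M + 1, fun N hN => ?_⟩
      obtain ⟨φ, h₀, h₁⟩ := hM N (by omega)
      obtain ⟨ψ, hψ⟩ := exists_flip (by omega) φ
      refine ⟨ψ, fun P hP => ?_, fun P hP => ?_⟩
      · have := h₁ P hP
        simpa [falseAlarm, missedDetection, hψ] using this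
      · rw [show P = fun _ => P₁ from funext fun k => eq_of_mem_contaminationClass_zero (hP k)]
        simpa [falseAlarm, missedDetection, hψ] using h₀

end Tandem

theorem theorem3 {Y : Type*} [MeasurableSpace Y]
    (P₀ P₁ : ProbabilityMeasure Y)
    (h₀₁ : (P₀ : Measure Y) ≪ (P₁ : Measure Y)) (h₁₀ : (P₁ : Measure Y) ≪ (P₀ : Measure Y))
    (ε₀ ε₁ : ℝ) (hε₀ : ε₀ ∈ Set.Ico (0 : ℝ) 1) (hε₁ : ε₁ ∈ Set.Ico (0 : ℝ) 1)
    (hdisj : Disjoint (Tandem.contaminationClass ε₀ P₀) (Tandem.contaminationClass ε₁ P₁))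
    (π₀ π₁ : ℝ) (hπ₀ : 0 < π₀) (hπ₁ : 0 < π₁) (hπ : π₀ + π₁ = 1) :
    (Tendsto (fun N : ℕ => Tandem.minimaxError π₀ π₁ (Tandem.contaminationClass ε₀ P₀)
          (Tandem.contaminationClass ε₁ P₁) N) atTop (𝓝 0) ↔
      (ε₀ = 0 ∧ ¬ IsBoundedUnder (· ≤ ·) (ae (P₀ : Measure Y))
          (llr (P₁ : Measure Y) (P₀ : Measure Y))) ∨
      (ε₁ = 0 ∧ ¬ IsBoundedUnder (· ≥ ·) (ae (P₀ : Measure Y))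
          (llr (P₁ : Measure Y) (P₀ : Measure Y)))) ∧
    ∀ φ : (N : ℕ) → Fin N → Tandem.DecisionRule Y,
      (∀ (N : ℕ) (ψ : Fin N → Tandem.DecisionRule Y),
        Tandem.maxError π₀ π₁ (Tandem.contaminationClass ε₀ P₀)
            (Tandem.contaminationClass ε₁ P₁) (φ N) ≤
          Tandem.maxError π₀ π₁ (Tandem.contaminationClass ε₀ P₀)
            (Tandem.contaminationClass ε₁ P₁) ψ) →
      (Tendsto (fun N : ℕ => Tandem.maxError π₀ π₁ (Tandem.contaminationClass ε₀ P₀)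
          (Tandem.contaminationClass ε₁ P₁) (φ N)) atTop (𝓝 0) ↔
        (ε₀ = 0 ∧ ¬ IsBoundedUnder (· ≤ ·) (ae (P₀ : Measure Y))
            (llr (P₁ : Measure Y) (P₀ : Measure Y))) ∨
        (ε₁ = 0 ∧ ¬ IsBoundedUnder (· ≥ ·) (ae (P₀ : Measure Y))
            (llr (P₁ : Measure Y) (P₀ : Measure Y)))) := by
  have main := Tandem.tendsto_minimaxError_zero_iff P₀ P₁ h₀₁ h₁₀ ε₀ ε₁ hε₀ hε₁ π₀ π₁ hπ₀ hπ₁ hπ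
  refine ⟨main, fun φ hφ => ?_⟩
  rw [← main]
  refine tendsto_congr fun N => le_antisymm (le_ciInf (hφ N)) ?_
  exact ciInf_le (Tandem.bddBelow_maxError hπ₀.le hπ₁.le _ _ N) (φ N)
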